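/- Let $J_X,J_Y,J_Z\in\mathbb C$ and let $2\le k\le L$. Consider a periodic chain of $L$ spins $1/2$, with sites taken modulo $L$; $A_i$ denotes the $2\times2$ matrix $A$ acting on site $i$, and $X,Y,Z$ are the Pauli matrices. **Coefficients.** For $n,N_x,N_y,N_z\ge0$ put $$S_n(N_x,N_y,N_z)=\sum_{n_x+n_y+n_z=n}\binom{n_x+N_x-1}{N_x-1}\binom{n_y+N_y-1}{N_y-1}\binom{n_z+N_z-1}{N_z-1}J_X^{2n_x}J_Y^{2n_y}J_Z^{2n_z},$$ where $\binom{a-1}{-1}$ is $1$ for $a=0$ and $0$ for $a>0$, and $$R_n(N_x,N_y,N_z)=4S_n(N_x+n,N_y+n,N_z+n)-S_n(N_x+n+1,N_y+n,N_z+n)-S_n(N_x+n,N_y+n+1,N_z+n)-S_n(N_x+n,N_y+n,N_z+n+1).$$ **Charge.** For letters $B_1,\dots,B_l\in\{X,Y,Z\}$ the doubling product is $\sum_{i=1}^{L}(B_1)_i(B_1B_2)_{i+1}\cdots(B_{l-1}B_l)_{i+l-1}(B_l)_{i+l}$. For $A_1,\dots,A_t\in\{X,Y,Z\}$ with $A_r\ne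 A_{r+1}$ and $m_1,\dots,m_t\ge0$, let $\overline{A_1^{m_1+1}\cdots A_t^{m_t+1}}$ be $(-\mathrm i)^{t-1}$ times the doubling product of the word in which each $A_r$ is repeated $m_r+1$ times. The $k$-th local charge of the XYZ chain is $$Q_k=\sum_{\substack{n,m\ge0\\ n+m<\lfloor k/2\rfloor}}\ \sum_{(A_r),(m_r)}R_n(N_x+m,N_y+m,N_z+m)\,J_{\boldsymbol A}\,\overline{A_1^{m_1+1}\cdots A_t^{m_t+1}},\qquad J_{\boldsymbol A}=(J_XJ_YJ_Z)^m\prod_{r=1}^tJ_{A_r}^{1-m_r},$$ where $t=k-2(n+m)-1$, the inner sum runs over all words as above with $\sum_r m_r=m$ (that is, length $k-2n-m-1$ with $m$ holes), $N_x,N_y,N_z$ count the letters $X,Y,Z$ in $A_1\cdots A_t$, and $J_{\boldsymbol A}$ is understood as a monomial in $J_X,J_Y,J_Z$ (its exponents are nonnegative). **Local tensors.** Let $\vec\sigma_i=(X_i,Y_i,Z_i)$, and let $\boldsymbol M_i$ be the $3\times3$ matrix with zero diagonal and entries $-\mathrm i\,(\alpha\beta)_i$ for $\alpha\ne\beta$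 in $\{X,Y,Z\}$. Let $\boldsymbol J=\mathrm{diag}(J_X,J_Y,J_Z)$ and $\boldsymbol R^n=\mathrm{diag}(R_n(1,0,0),R_n(0,1,0),R_n(0,0,1))$, and put $\vec\sigma_i^{\,n}=\vec\sigma_i\boldsymbol J\boldsymbol R^n$, $\boldsymbol M_i^n=\boldsymbol M_i\boldsymbol J\boldsymbol R^n$ and $\boldsymbol e^n=R_n(1,1,1)\,\mathrm{diag}(J_YJ_Z,J_XJ_Z,J_XJ_Y)\,I$. Let $\epsilon$ be a dual number, $\epsilon^2=0$. The tensor $\Gamma_k^i$ is the $k\times k$ block matrix, with first block of size $1$ and the other $k-1$ blocks of size $3$, whose block $(a,b)$ is: $I$ if $(a,b)=(1,1)$; $\epsilon\vec\sigma_i^{\top}$ if $(a,b)=(k,1)$; $\vec\sigma_i^{\,b/2-1}$ if $a=1$ and $b$ is even; $\boldsymbol M_i^{(b-a-1)/2}$ if $1<a<b$ and $b-a$ is odd; $\boldsymbol e^{(b-a)/2-1}$ if $1<a<b$ and $b-a$ is even; and zero otherwise. **Theorem.** The auxiliary space of $\Gamma_k^i$ has dimension $3k-2$; all blocks of $\Gamma_k^i$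 strictly below the diagonal vanish, except the corner block $(k,1)$; and $$\mathrm{Tr}_a\left[\Gamma_k^1\Gamma_k^2\cdots\Gamma_k^L\right]=I+\epsilon\,Q_k .$$ -/

import Mathlib

noncomputable section

namespace XYZChain

/-- The three letters `X`, `Y`, `Z`. -/
inductive Letter : Type
  | X | Y | Z
  deriving DecidableEq

instance : Fintype Letter where
  elems := {Letter.X, Letter.Y, Letter.Z}
  complete := by intro α; cases α <;> simp

/-- The Pauli matrices. -/
def pauli : Letter → Matrix (Fin 2) (Fin 2) ℂ
  | .X => !![0, 1; 1, 0]
  | .Y => !![0, -Complex.I; Complex.I, 0]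
  | .Z => !![1, 0; 0, -1]

/-- Operators on `(ℂ²)^{⊗ L}`, as matrices in the product basis (indexed by spin configurations). -/
abbrev Op (L : ℕ) : Type := Matrix (Fin L → Fin 2) (Fin L → Fin 2) ℂ

/-- The operator `A_i` acting as `A` on site `i` and as the identity on all other sites. -/
def siteOp {L : ℕ} (i : Fin L) (A : Matrix (Fin 2) (Fin 2) ℂ) : Op L :=
  Matrix.of fun s t => if ∀ j, j ≠ i → s j = t j then A (s i) (t i) else 0

/-! ### Doubling products -/

/-- `doublingString B [A₁, …, A_l] i = (B A₁)_i (A₁ A₂)_{i+1} ⋯ (A_{l-1} A_l)_{i+l-1} (A_l)_{i+l}`.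
Sites are added modulo `L` (periodic boundary conditions). -/
def doublingString {L : ℕ} [NeZero L] :
    Matrix (Fin 2) (Fin 2) ℂ → List Letter → Fin L → Op L
  | B, [], i => siteOp i B
  | B, A :: w, i => siteOp i (B * pauli A) * doublingString (pauli A) w (i + 1)

/-- The doubling product `∑ᵢ (A₁)_i (A₁ A₂)_{i+1} ⋯ (A_{l-1} A_l)_{i+l-1} (A_l)_{i+l}`. -/
def doublingProduct (L : ℕ) [NeZero L] (w : List Letter) : Op L :=
  ∑ i : Fin L, doublingString 1 w i

/-- The word `A₁ ⋯ A₁ A₂ ⋯ A₂ ⋯ A_t ⋯ A_t` in which `A_r` is repeated `μ_r + 1` times. -/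
def runWord {t : ℕ} (A : Fin t → Letter) (μ : Fin t → ℕ) : List Letter :=
  (List.ofFn fun r => List.replicate (μ r + 1) (A r)).flatten

/-- The abbreviated doubling product of `A₁^{μ₁+1} ⋯ A_t^{μ_t+1}`,
which carries the extra factor `(-i)^{t-1}`. -/
def abbrevDoubling (L : ℕ) [NeZero L] {t : ℕ} (A : Fin t → Letter) (μ : Fin t → ℕ) : Op L :=
  (-Complex.I) ^ (t - 1) • doublingProduct L (runWord A μ)

/-- The doubling products `A₁^{μ₁+1} ⋯ A_t^{μ_t+1}` (neighbouring letters distinct) with `t` runs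
and `m` holes, that is, with length `t + m` and `m = ∑ μ_r`, as formal words. -/
def doublingSet (t m : ℕ) : Finset ((Fin t → Letter) × (Fin t → ℕ)) :=
  (Finset.univ.filter fun A : Fin t → Letter =>
      ∀ r s : Fin t, (r : ℕ) + 1 = (s : ℕ) → A r ≠ A s) ×ˢ
    Finset.piAntidiag Finset.univ m

/-! ### Coefficients -/

/-- The binomial coefficient `C(a + N - 1, N - 1)`, with the convention that for `N = 0`
it is `1` if `a = 0` and `0` otherwise. -/
def multiBinom (a N : ℕ) : ℕ :=
  if N = 0 then (if a = 0 then 1 else 0) else (a + N - 1).choose (N - 1)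

/-- `S_n(N_x, N_y, N_z) = ∑_{n_x + n_y + n_z = n} ∏_α C(n_α + N_α - 1, N_α - 1) (J_α²)^{n_α}`. -/
def coeffS (J : Letter → ℂ) (n : ℕ) (N : Letter → ℕ) : ℂ :=
  ∑ ν ∈ Finset.piAntidiag (Finset.univ : Finset Letter) n,
    ∏ α, (multiBinom (ν α) (N α) : ℂ) * (J α ^ 2) ^ ν α

/-- `R_n(N) = 4 S_n(N + n) - ∑_α S_n(N + n + δ_α)`. -/
def coeffR (J : Letter → ℂ) (n : ℕ) (N : Letter → ℕ) : ℂ :=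
  4 * coeffS J n (fun β => N β + n)
    - ∑ α, coeffS J n (fun β => N β + n + if β = α then 1 else 0)

/-- The product of the two couplings other than `J_α`. -/
def otherJ (J : Letter → ℂ) (α : Letter) : ℂ := ∏ β ∈ Finset.univ.erase α, J β

/-- `J_A = (J_X J_Y J_Z)^m ∏_r J_{A_r}^{1 - μ_r}` with `m = ∑ μ_r`, written as the monomial with
nonnegative exponents that it is, so that vanishing couplings are allowed. -/
def couplingJ (J : Letter → ℂ) {t : ℕ} (A : Fin t → Letter) (μ : Fin t → ℕ) : ℂ :=
  ∏ r, J (A r) * otherJ J (A r) ^ μ r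

theorem couplingJ_eq (J : Letter → ℂ) (hJ : ∀ α, J α ≠ 0) {t : ℕ} (A : Fin t → Letter)
    (μ : Fin t → ℕ) :
    couplingJ J A μ =
      (J .X * J .Y * J .Z) ^ (∑ r, μ r) * ∏ r, J (A r) ^ (1 - (μ r : ℤ)) := by
  have h : ∀ α, J .X * J .Y * J .Z = J α * otherJ J α := by
    intro α
    have h1 : J .X * J .Y * J .Z = ∏ β, J β := by
      change _ = ∏ β ∈ {Letter.X, Letter.Y, Letter.Z}, J β
      simp [mul_assoc]
    rw [h1, otherJ, Finset.mul_prod_erase _ _ (Finset.mem_univ α)]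
  rw [couplingJ, ← Finset.prod_pow_eq_pow_sum, ← Finset.prod_mul_distrib]
  refine Finset.prod_congr rfl fun r _ => ?_
  rw [h (A r), mul_pow, zpow_sub₀ (hJ _), zpow_one, zpow_natCast]
  have := pow_ne_zero (μ r) (hJ (A r))
  field_simp

/-- The number of occurrences of the letter `α` in `A₁ ⋯ A_t`. -/
def letterCount {t : ℕ} (A : Fin t → Letter) (α : Letter) : ℕ :=
  (Finset.univ.filter fun r => A r = α).card

/-- The charge `Q_k` on the periodic chain of length `L`: the sum over `n, m ≥ 0` with
`n + m < ⌊k/2⌋` and over the doubling products with `t = k - 2 (n + m) - 1` runs and `m` holes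
(length `k - 2 n - m - 1`) of `R_n(N_x + m, N_y + m, N_z + m) J_A` times the doubling product. -/
def charge (J : Letter → ℂ) (L : ℕ) [NeZero L] (k : ℕ) : Op L :=
  ∑ p ∈ (Finset.range (k / 2) ×ˢ Finset.range (k / 2)).filter (fun p => p.1 + p.2 < k / 2),
    ∑ w ∈ doublingSet (k - 2 * (p.1 + p.2) - 1) p.2,
      (coeffR J p.1 (fun α => letterCount w.1 α + p.2) * couplingJ J w.1 w.2) •
        abbrevDoubling L w.1 w.2

/-! ### Local tensors -/

/-- Entry `α` of the row `σ_i = (X_i, Y_i, Z_i)`. -/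
def sigma {L : ℕ} (i : Fin L) (α : Letter) : Op L := siteOp i (pauli α)

/-- Entries of `M_i`: `-i (α β)_i` off the diagonal, and `0` on it. -/
def blockM {L : ℕ} (i : Fin L) (α β : Letter) : Op L :=
  if α = β then 0 else (-Complex.I) • siteOp i (pauli α * pauli β)

/-- The diagonal entries of the matrix `R^n`: `R_n(1,0,0)`, `R_n(0,1,0)`, `R_n(0,0,1)`. -/
def diagR (J : Letter → ℂ) (n : ℕ) (α : Letter) : ℂ :=
  coeffR J n (fun β => if β = α then 1 else 0)

/-- Entries of `σ_i^n = σ_i J R^n`, where `J` and `R^n` are diagonal. -/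
def sigmaN (J : Letter → ℂ) {L : ℕ} (n : ℕ) (i : Fin L) (β : Letter) : Op L :=
  (J β * diagR J n β) • sigma i β

/-- Entries of `M_i^n = M_i J R^n`. -/
def blockMN (J : Letter → ℂ) {L : ℕ} (n : ℕ) (i : Fin L) (α β : Letter) : Op L :=
  (J β * diagR J n β) • blockM i α β

/-- Entries of `e^n = R_n(1,1,1) diag(J_Y J_Z, J_X J_Z, J_X J_Y)`. -/
def blockEN (J : Letter → ℂ) (L : ℕ) (n : ℕ) (α β : Letter) : Op L :=
  if α = β then (otherJ J α * coeffR J n (fun _ => 1)) • (1 : Op L) else 0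

/-- Index set of the auxiliary space: block `1` has size one (`Sum.inl ()`), and each of the
blocks `2, …, k` has size three (`Sum.inr (a, α)` lies in block `a + 2`). -/
abbrev Aux (k : ℕ) : Type := Unit ⊕ (Fin (k - 1) × Letter)

/-- The number, from `1` to `k`, of the block in which an auxiliary index lies. -/
def blockPos {k : ℕ} : Aux k → ℕ
  | Sum.inl _ => 1
  | Sum.inr p => (p.1 : ℕ) + 2

/-- The local tensor `Γ_k^i`, with entries in the dual numbers over the operator algebra. -/
def localTensor (J : Letter → ℂ) {L : ℕ} (k : ℕ) (i : Fin L) :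
    Matrix (Aux k) (Aux k) (DualNumber (Op L)) :=
  Matrix.of fun p q =>
    let a := blockPos p
    let b := blockPos q
    match p, q with
    | Sum.inl _, Sum.inl _ => 1
    | Sum.inr (_, α), Sum.inl _ =>
        if a = k then DualNumber.eps * TrivSqZeroExt.inl (sigma i α) else 0
    | Sum.inl _, Sum.inr (_, β) =>
        if Even b then TrivSqZeroExt.inl (sigmaN J (b / 2 - 1) i β) else 0
    | Sum.inr (_, α), Sum.inr (_, β) =>
        if a < b then
          if Odd (b - a) then TrivSqZeroExt.inl (blockMN J ((b - a - 1) / 2) i α β)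
          else TrivSqZeroExt.inl (blockEN J L ((b - a) / 2 - 1) α β)
        else 0

end XYZChain

end

/-!
Write each local tensor as `U + ε C`, where the bulk `U` is block triangular, with a vanishing
diagonal apart from the entry `1` in the first block, and `C` has only the corner block `(k, 1)`.
The part of the trace of order zero in `ε` is therefore `1`. In the part of order one the corner
occurs once; operators at different sites commute, so the factors after the corner can be moved in
front of the others (`trace_mul_cornerMatrix_mul`), and what remains is a sum over closed paths
that leave the first block at some site, climb to the last block and return through the corner.
Every path from the first block to the corner occupies at most `k` sites, so for `k ≤ L` all of
them fit on the chain.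

A step of such a path either starts a new run, with a letter different from the preceding one (or
the first letter), or makes a hole, which repeats the letter. The operators along a path hence
multiply to a doubling product string whose word is the sequence of letters
(`sum_bulk_mul_pathVec`), and the superscripts `n` of the steps only enter the coefficient. With
superscript `n` a run step climbs `2 n + 1` blocks and a hole step `2 n + 2`, and altogether
`k - 1` blocks have to be climbed. For a word with `t` runs and `m` holes the superscripts thus
add up to the `n` with `t + 2 (n + m) = k - 1`, and its coefficient is, apart from the couplings
and the phase `(-i)^(t-1)`, the coefficient of `xⁿ` in the product of the series `∑ R_n(δ_α) xⁿ` over the runs and of `∑ R_n(1,1,1) xⁿ` over the holes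
(`coeff_wordSeries_runWord`).

That this equals `R_n(N_x + m, N_y + m, N_z + m)` is the multiplicativity of `∑ R_n(N) xⁿ` in `N`
(`genR_add`), a case of Lagrange inversion. With `φ_α = 1 / (1 - J_α² z)` and `Φ = φ_X φ_Y φ_Z` one
has `S_n(N) = [zⁿ] ∏ φ_α ^ N_α` and `1 - z Φ' / Φ = 4 - ∑ φ_α`, so that
`R_n(N) = [zⁿ] (∏ φ_α ^ N_α) Φⁿ (1 - z Φ' / Φ)` is the coefficient of `xⁿ` in `∏ φ_α(z) ^ N_α` when
`x = z / Φ(z)`. Run-length encoding finally identifies the words with the index set of the charge (`charge_eq_sum_words`).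
-/

namespace XYZChain

/-! ### Lagrange inversion -/

section Lagrange

open PowerSeries

/-- Modulo `zⁿ`, every power series is a polynomial in `ψ = z / φ`, because `ψ` is `z` times a
unit. -/
theorem exists_polynomial_approx {F : Type*} [Field F] {φ ψ : F⟦X⟧} (hφ : constantCoeff φ = 1)
    (hψ : ψ * φ = X) (H : F⟦X⟧) (n : ℕ) :
    ∃ P : Polynomial F, (X : F⟦X⟧) ^ n ∣ H - Polynomial.aeval ψ P := by
  induction n with
  | zero => exact ⟨0, by simp⟩
  | succ n ih =>
    obtain ⟨P, r, hr⟩ := ih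
    refine ⟨P + Polynomial.C (constantCoeff r) * Polynomial.X ^ n, ?_⟩
    have hunit : IsUnit (φ ^ n) := (isUnit_iff_constantCoeff.2 (by simp [hφ])).pow n
    have h : (H - Polynomial.aeval ψ (P + Polynomial.C (constantCoeff r) * Polynomial.X ^ n)) * φ ^ n
        = X ^ n * (r * φ ^ n - C (constantCoeff r)) := by
      have h1 : ψ ^ n * φ ^ n = X ^ n := by rw [← mul_pow, hψ]
      simp only [map_add, map_mul, Polynomial.aeval_C, Polynomial.aeval_X, map_pow]
      rw [show (algebraMap F F⟦X⟧) (constantCoeff r) = C (constantCoeff r) from rfl]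
      linear_combination φ ^ n * hr - C (constantCoeff r) * h1
    rw [← hunit.dvd_mul_right, h, pow_succ]
    refine mul_dvd_mul_left _ (X_dvd_iff.2 ?_)
    simp [hφ]

/-- The key coefficient in Lagrange inversion: the functional
`H ↦ [zⁿ] H φⁿ (1 - z φ' / φ)` is dual to the powers of `ψ = z / φ`. -/
theorem coeff_pow_mul_pow_mul {F : Type*} [Field F] [CharZero F] {φ ψ θ : F⟦X⟧}
    (hφ : constantCoeff φ = 1) (hψ : ψ * φ = X) (hθ : θ * φ = φ - X * derivative F φ) (j n : ℕ) :
    coeff n (ψ ^ j * φ ^ n * θ) = if n = j then 1 else 0 := by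
  rcases lt_or_ge n j with h | h
  · rw [if_neg (by omega)]
    have hX : (X : F⟦X⟧) ∣ ψ := by
      rw [X_dvd_iff]
      simpa [hφ] using congrArg constantCoeff hψ
    have : (X : F⟦X⟧) ^ j ∣ ψ ^ j * φ ^ n * θ :=
      ((pow_dvd_pow_of_dvd hX j).mul_right _).mul_right _
    exact X_pow_dvd_iff.1 this n h
  · obtain ⟨d, rfl⟩ := Nat.exists_eq_add_of_le h
    have h1 : ψ ^ j * φ ^ (j + d) * θ = X ^ j * (φ ^ d * θ) := by
      rw [pow_add, ← hψ]; ring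
    rw [h1, add_comm j d, coeff_X_pow_mul]
    rcases d with _ | e
    · simpa [hφ] using congrArg constantCoeff hθ
    · rw [if_neg (by omega)]
      have h2 : φ ^ (e + 1) * θ = φ ^ (e + 1) - X * (φ ^ e * derivative F φ) := by
        linear_combination φ ^ e * hθ
      have h3 : coeff e (derivative F (φ ^ (e + 1))) =
          (e + 1) * coeff e (φ ^ e * derivative F φ) := by
        rw [Derivation.leibniz_pow]
        rw [Nat.add_sub_cancel, smul_eq_mul, nsmul_eq_mul, ← map_natCast (C (R := F)), coeff_C_mul]
        push_cast
        ring
      rw [coeff_derivative] at h3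
      have h4 : (e : F) + 1 ≠ 0 := by exact_mod_cast e.succ_ne_zero
      rw [h2, map_sub, coeff_succ_X_mul, sub_eq_zero]
      exact mul_left_cancel₀ h4 (by rw [← h3, mul_comm])

/-- Multiplicativity of Lagrange inversion: `∑ₙ xⁿ [zⁿ] H φⁿ (1 - z φ' / φ)` is the series `H`
composed with the inverse of `z ↦ z / φ`, so it depends multiplicatively on `H`. -/
theorem coeff_mul_pow_mul {F : Type*} [Field F] [CharZero F] {φ ψ θ : F⟦X⟧}
    (hφ : constantCoeff φ = 1) (hψ : ψ * φ = X) (hθ : θ * φ = φ - X * derivative F φ)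
    (H K : F⟦X⟧) (n : ℕ) :
    coeff n (H * K * φ ^ n * θ) = ∑ p ∈ Finset.HasAntidiagonal.antidiagonal n,
      coeff p.1 (H * φ ^ p.1 * θ) * coeff p.2 (K * φ ^ p.2 * θ) := by
  have main : ∀ (H : F⟦X⟧) (P : Polynomial F), (X : F⟦X⟧) ^ (n + 1) ∣ H - Polynomial.aeval ψ P →
      ∀ i ≤ n, coeff i (H * φ ^ i * θ) = P.coeff i := by
    intro H P hP i hi
    have h1 : (X : F⟦X⟧) ^ (n + 1) ∣ (H - Polynomial.aeval ψ P) * (φ ^ i * θ) := hP.mul_right _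
    have h2 := X_pow_dvd_iff.1 h1 i (by omega)
    rw [sub_mul, map_sub, sub_eq_zero, ← mul_assoc] at h2
    rw [h2, Polynomial.aeval_eq_sum_range, Finset.sum_mul, map_sum]
    have h3 : ∀ j, coeff i (P.coeff j • ψ ^ j * (φ ^ i * θ)) = P.coeff j * if i = j then 1 else 0 := by
      intro j
      rw [smul_mul_assoc, coeff_smul, ← mul_assoc, coeff_pow_mul_pow_mul hφ hψ hθ, smul_eq_mul]
    simp only [h3, mul_ite, mul_one, mul_zero, Finset.sum_ite_eq, Finset.mem_range]
    split_ifs with h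
    · rfl
    · exact (Polynomial.coeff_eq_zero_of_natDegree_lt (by omega)).symm
  obtain ⟨P, hP⟩ := exists_polynomial_approx hφ hψ H (n + 1)
  obtain ⟨Q, hQ⟩ := exists_polynomial_approx hφ hψ K (n + 1)
  have hPQ : (X : F⟦X⟧) ^ (n + 1) ∣ H * K - Polynomial.aeval ψ (P * Q) := by
    have : H * K - Polynomial.aeval ψ (P * Q) = (H - Polynomial.aeval ψ P) * K
        + Polynomial.aeval ψ P * (K - Polynomial.aeval ψ Q) := by rw [map_mul]; ring
    rw [this]
    exact dvd_add (hP.mul_right _) (hQ.mul_left _)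
  rw [main _ _ hPQ n le_rfl, Polynomial.coeff_mul]
  refine Finset.sum_congr rfl fun p hp => ?_
  have := Finset.HasAntidiagonal.mem_antidiagonal.1 hp
  rw [main _ _ hP _ (by omega), main _ _ hQ _ (by omega)]

end Lagrange

/-! ### The coefficients `R_n` as a multiplicative family of power series -/

section Coefficients

open PowerSeries

/-- The geometric series `1 / (1 - J_α² z)`. -/
noncomputable def geom (J : Letter → ℂ) (α : Letter) : ℂ⟦X⟧ := mk fun n => (J α ^ 2) ^ n

theorem geom_mul (J : Letter → ℂ) (α : Letter) : geom J α * (1 - C (J α ^ 2) * X) = 1 := by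
  ext n
  rw [mul_sub, mul_one, map_sub, mul_left_comm, coeff_C_mul]
  cases n with
  | zero => simp [geom]
  | succ n => simp [geom, coeff_succ_mul_X, pow_succ]; ring

theorem constantCoeff_geom (J : Letter → ℂ) (α : Letter) : constantCoeff (geom J α) = 1 := by
  simp [geom, ← coeff_zero_eq_constantCoeff_apply]

theorem coeff_geom_pow (J : Letter → ℂ) (α : Letter) (N n : ℕ) :
    coeff n (geom J α ^ N) = (multiBinom n N : ℂ) * (J α ^ 2) ^ n := by
  have h : geom J α = rescale (J α ^ 2) (mk 1) := by
    ext n; simp [geom, coeff_rescale]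
  rcases N with _ | N
  · rcases n with _ | n <;> simp [multiBinom, coeff_one]
  · rw [h, ← map_pow, mk_one_pow_eq_mk_choose_add, coeff_rescale, coeff_mk, multiBinom,
      if_neg N.succ_ne_zero, mul_comm, show n + (N + 1) - 1 = N + n by omega, Nat.add_sub_cancel]

theorem coeffS_eq (J : Letter → ℂ) (n : ℕ) (N : Letter → ℕ) :
    coeffS J n N = coeff n (∏ α, geom J α ^ N α) := by
  rw [coeff_prod, coeffS]
  simp only [coeff_geom_pow]
  refine Finset.sum_bij' (fun ν _ => Finsupp.equivFunOnFinite.symm ν) (fun l _ => l) ?_ ?_ ?_ ?_ ?_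
  · intro ν hν; simpa using hν
  · intro l hl; simpa using hl
  · intro ν _; rfl
  · intro l _; ext; rfl
  · intro ν _; rfl

/-- `R_n(N) = [zⁿ] φ^N Φⁿ (4 - ∑ φ_α)` with `φ_α = 1 / (1 - J_α² z)` and `Φ = φ_X φ_Y φ_Z`. -/
theorem coeffR_eq (J : Letter → ℂ) (n : ℕ) (N : Letter → ℕ) :
    coeffR J n N =
      coeff n ((∏ α, geom J α ^ N α) * (∏ α, geom J α) ^ n * (4 - ∑ α, geom J α)) := by
  have h (α : Letter) : ∏ β, geom J β ^ (N β + n + if β = α then 1 else 0) =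
      (∏ α, geom J α ^ N α) * (∏ α, geom J α) ^ n * geom J α := by
    simp only [pow_add, Finset.prod_mul_distrib, Finset.prod_pow]
    congr 1
    rw [Finset.prod_eq_single α] <;> simp +contextual
  simp only [coeffR, coeffS_eq, h]
  simp only [pow_add, Finset.prod_mul_distrib, Finset.prod_pow]
  rw [mul_sub, map_sub, Finset.mul_sum, map_sum]
  congr 1
  rw [mul_comm _ (4 : ℂ⟦X⟧), show (4 : ℂ⟦X⟧) = C 4 from (map_ofNat C 4).symm, coeff_C_mul]

theorem derivative_geom (J : Letter → ℂ) (α : Letter) :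
    X * derivative ℂ (geom J α) = geom J α * (geom J α - 1) := by
  have h := geom_mul J α
  have hd := congrArg (derivative ℂ) h
  simp only [Derivation.leibniz, map_sub, smul_eq_mul, Derivation.map_one_eq_zero,
    derivative_C, derivative_X] at hd
  have hd : geom J α * -C (J α ^ 2) + (1 - C (J α ^ 2) * X) * derivative ℂ (geom J α) = 0 := by
    linear_combination hd
  linear_combination (X * geom J α) * hd - (X * derivative ℂ (geom J α) + geom J α) * h

/-- The generating function `∑ₙ R_n(N) xⁿ`. -/
noncomputable def genR (J : Letter → ℂ) (N : Letter → ℕ) : ℂ⟦X⟧ := mk fun n => coeffR J n N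

theorem sum_letter {M : Type*} [AddCommMonoid M] (f : Letter → M) :
    ∑ α, f α = f .X + (f .Y + f .Z) := by
  change ∑ α ∈ {Letter.X, Letter.Y, Letter.Z}, f α = _
  simp

theorem prod_letter {M : Type*} [CommMonoid M] (f : Letter → M) :
    ∏ α, f α = f .X * (f .Y * f .Z) := by
  change ∏ α ∈ {Letter.X, Letter.Y, Letter.Z}, f α = _
  simp

/-- With `Φ = φ_X φ_Y φ_Z` one has `1 - z Φ' / Φ = 4 - ∑ φ_α`, so `R_n(N)` is a Lagrange
inversion coefficient, and its generating function is multiplicative in `φ^N`. -/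
theorem genR_add (J : Letter → ℂ) (N M : Letter → ℕ) :
    genR J (N + M) = genR J N * genR J M := by
  have hφ : constantCoeff (∏ α, geom J α) = 1 := by simp [constantCoeff_geom, prod_letter]
  have hψ : (X * ∏ α, (1 - C (J α ^ 2) * X)) * ∏ α, geom J α = X := by
    rw [mul_assoc, ← Finset.prod_mul_distrib]
    simp only [mul_comm _ (geom J _), geom_mul, Finset.prod_const_one, mul_one]
  have hθ : (4 - ∑ α, geom J α) * ∏ α, geom J α =
      (∏ α, geom J α) - X * derivative ℂ (∏ α, geom J α) := by
    have hd := derivative_geom J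
    simp only [prod_letter, sum_letter, Derivation.leibniz, smul_eq_mul]
    linear_combination geom J .Y * geom J .Z * hd .X + geom J .X * geom J .Z * hd .Y +
      geom J .X * geom J .Y * hd .Z
  ext n
  rw [coeff_mul]
  simp only [genR, coeff_mk, coeffR_eq]
  rw [← coeff_mul_pow_mul hφ hψ hθ]
  simp [pow_add, Finset.prod_mul_distrib]

theorem genR_zero (J : Letter → ℂ) : genR J 0 = 1 := by
  have h : genR J 0 * genR J 0 = genR J 0 * 1 := by rw [← genR_add, add_zero, mul_one]
  refine mul_left_cancel₀ (fun h0 => ?_) h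
  have h1 := congrArg (coeff 0) h0
  rw [genR, coeff_mk, coeffR_eq] at h1
  have h4 : constantCoeff (4 : ℂ⟦X⟧) = 4 := map_ofNat _ 4
  simp [constantCoeff_geom, prod_letter, sum_letter, h4] at h1
  norm_num at h1

end Coefficients

/-! ### Operators at different sites -/

theorem siteOp_mul_apply {L : ℕ} {i j : Fin L} (hij : i ≠ j) (A B : Matrix (Fin 2) (Fin 2) ℂ)
    (s t : Fin L → Fin 2) :
    (siteOp i A * siteOp j B) s t =
      if ∀ l, l ≠ i → l ≠ j → s l = t l then A (s i) (t i) * B (s j) (t j) else 0 := by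
  -- the only intermediate configuration that contributes is `s` with site `i` replaced by `t i`
  rw [Matrix.mul_apply, Finset.sum_eq_single (Function.update s i (t i))]
  · have h1 : ∀ l, l ≠ i → s l = Function.update s i (t i) l := fun l hl => by simp [hl]
    have h2 : (∀ l, l ≠ j → Function.update s i (t i) l = t l) ↔
        ∀ l, l ≠ i → l ≠ j → s l = t l := by
      refine forall_congr' fun l => ?_
      by_cases hl : l = i
      · subst hl; simp
      · simp [hl]
    simp only [siteOp, Matrix.of_apply, if_pos h1, h2]
    simp [hij.symm]
  · intro u _ hu
    simp only [siteOp, Matrix.of_apply]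
    by_cases h1 : ∀ l, l ≠ i → s l = u l
    · by_cases h2 : ∀ l, l ≠ j → u l = t l
      · refine absurd (funext fun l => ?_) hu
        by_cases hl : l = i
        · subst hl; simp [h2 l hij]
        · simp [hl, h1 l hl]
      · rw [if_neg h2, mul_zero]
    · rw [if_neg h1, zero_mul]
  · simp

theorem siteOp_commute {L : ℕ} {i j : Fin L} (hij : i ≠ j) (A B : Matrix (Fin 2) (Fin 2) ℂ) :
    Commute (siteOp i A) (siteOp j B) := by
  ext s t
  rw [siteOp_mul_apply hij, siteOp_mul_apply hij.symm, mul_comm (B _ _)]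
  congr 1
  exact propext ⟨fun h l hi hj => h l hj hi, fun h l hi hj => h l hj hi⟩

theorem siteOp_one {L : ℕ} (i : Fin L) : siteOp i 1 = 1 := by
  ext s t
  simp only [siteOp, Matrix.of_apply, Matrix.one_apply]
  by_cases h : s = t
  · simp [h]
  · rw [if_neg h]
    split_ifs with h1 h2
    · exact absurd (funext fun l => if hl : l = i then hl ▸ h2 else h1 l hl) h
    · rfl
    · rfl

/-! ### The dual-number components of the local tensor -/

/-- The part of the local tensor of order zero in `ε`. -/
def bulk (J : Letter → ℂ) {L : ℕ} (k : ℕ) (i : Fin L) : Matrix (Aux k) (Aux k) (Op L) :=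
  (localTensor J k i).map TrivSqZeroExt.fst

/-- The corner block `(k, 1)` of the local tensor without its factor `ε`, as a column. -/
def corner {L : ℕ} (k : ℕ) (i : Fin L) : Aux k → Op L
  | Sum.inl _ => 0
  | Sum.inr (a, α) => if (a : ℕ) + 2 = k then sigma i α else 0

/-- The part of the local tensor of order one in `ε`: its only nonzero column is `corner`. -/
def cornerMatrix {L : ℕ} (k : ℕ) (i : Fin L) : Matrix (Aux k) (Aux k) (Op L) :=
  Matrix.of fun p q => if q = Sum.inl () then corner k i p else 0

section Components

variable (J : Letter → ℂ) {L : ℕ} (k : ℕ) (i : Fin L)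

theorem localTensor_snd (p q : Aux k) :
    (localTensor J k i p q).snd = cornerMatrix k i p q := by
  rcases p with _ | ⟨a, α⟩ <;> rcases q with _ | ⟨b, β⟩
  · simp [localTensor, cornerMatrix, corner]
  · simp only [localTensor, Matrix.of_apply, cornerMatrix]
    split_ifs <;> simp_all
  · simp only [localTensor, Matrix.of_apply, cornerMatrix, corner, blockPos]
    split_ifs <;> simp_all
  · simp only [localTensor, Matrix.of_apply, cornerMatrix]
    split_ifs <;> simp_all

theorem bulk_inl_inl : bulk J k i (Sum.inl ()) (Sum.inl ()) = 1 := by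
  simp [bulk, localTensor]

theorem bulk_inr_inl (p : Fin (k - 1) × Letter) : bulk J k i (Sum.inr p) (Sum.inl ()) = 0 := by
  simp only [bulk, localTensor, Matrix.of_apply, Matrix.map_apply]
  split_ifs <;> simp

theorem bulk_inl_inr (b : Fin (k - 1)) (β : Letter) :
    bulk J k i (Sum.inl ()) (Sum.inr (b, β)) =
      if Even (b : ℕ) then sigmaN J (b / 2) i β else 0 := by
  simp only [bulk, localTensor, Matrix.of_apply, Matrix.map_apply, blockPos]
  rw [show ((b : ℕ) + 2) / 2 - 1 = b / 2 by omega]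
  have : Even ((b : ℕ) + 2) ↔ Even (b : ℕ) := by simp [Nat.even_add]
  simp only [this]
  split_ifs <;> simp

theorem bulk_inr_inr (a b : Fin (k - 1)) (α β : Letter) :
    bulk J k i (Sum.inr (a, α)) (Sum.inr (b, β)) =
      if (a : ℕ) < b then
        if Odd ((b : ℕ) - a) then blockMN J (((b : ℕ) - a - 1) / 2) i α β
        else blockEN J L (((b : ℕ) - a) / 2 - 1) α β
      else 0 := by
  simp only [bulk, localTensor, Matrix.of_apply, Matrix.map_apply, blockPos,
    Nat.add_sub_add_right, add_lt_add_iff_right]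
  split_ifs <;> simp

theorem commute_bulk {i : Fin L} {x : Op L} (hx : ∀ A, Commute x (siteOp i A)) (p q : Aux k) :
    Commute x (bulk J k i p q) := by
  rcases p with _ | ⟨a, α⟩ <;> rcases q with _ | ⟨b, β⟩
  · rw [bulk_inl_inl]; exact Commute.one_right x
  · rw [bulk_inl_inr]
    split_ifs
    · exact (hx _).smul_right _
    · exact Commute.zero_right x
  · rw [bulk_inr_inl]; exact Commute.zero_right x
  · rw [bulk_inr_inr]
    split_ifs
    · rw [blockMN, blockM]
      split_ifs
      · rw [smul_zero]; exact Commute.zero_right x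
      · exact ((hx _).smul_right _).smul_right _
    · rw [blockEN]
      split_ifs
      · exact (Commute.one_right x).smul_right _
      · exact Commute.zero_right x
    · exact Commute.zero_right x

theorem commute_corner {i : Fin L} {x : Op L} (hx : ∀ A, Commute x (siteOp i A)) (p : Aux k) :
    Commute x (corner k i p) := by
  rcases p with _ | ⟨a, α⟩
  · exact Commute.zero_right x
  · rw [corner]
    split_ifs
    · exact hx _
    · exact Commute.zero_right x

theorem commute_bulk_prod {l : List (Fin L)} {x : Op L}
    (hx : ∀ i ∈ l, ∀ A, Commute x (siteOp i A)) (p q : Aux k) :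
    Commute x ((l.map (bulk J k)).prod p q) := by
  induction l generalizing p with
  | nil =>
    simp only [List.map_nil, List.prod_nil, Matrix.one_apply]
    split_ifs
    · exact Commute.one_right x
    · exact Commute.zero_right x
  | cons i l ih =>
    rw [List.map_cons, List.prod_cons, Matrix.mul_apply]
    exact Commute.sum_right _ _ _ fun r _ =>
      (commute_bulk J k (hx i (by simp)) p r).mul_right
        (ih (fun j hj => hx j (by simp [hj])) r)

/-! ### The trace of a product of local tensors -/

theorem fst_prod (l : List (Fin L)) (p q : Aux k) :
    ((l.map (localTensor J k)).prod p q).fst = (l.map (bulk J k)).prod p q := by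
  have h := map_list_prod (RingHom.mapMatrix (m := Aux k)
    (TrivSqZeroExt.fstHom ℂ (Op L) (Op L)).toRingHom) (l.map (localTensor J k))
  have h' := congrFun (congrFun h p) q
  rw [List.map_map] at h'
  exact h'

/-- The Leibniz rule: the `ε`-part of a product puts the corner at one of the sites. -/
theorem snd_prod (l : List (Fin L)) (p q : Aux k) :
    ((l.map (localTensor J k)).prod p q).snd = ∑ j : Fin l.length,
      (((l.take j).map (bulk J k)).prod * cornerMatrix k l[j] *
        ((l.drop (j + 1)).map (bulk J k)).prod) p q := by
  induction l generalizing p with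
  | nil => simp [Matrix.one_apply]; split_ifs <;> simp
  | cons i l ih =>
    rw [List.map_cons, List.prod_cons, Matrix.mul_apply, TrivSqZeroExt.snd_sum]
    simp only [DualNumber.snd_mul, Finset.sum_add_distrib, fst_prod, ih, localTensor_snd]
    erw [Fin.sum_univ_succ]
    rw [add_comm]
    congr 1
    · simp [Matrix.mul_apply]
    · simp only [Finset.mul_sum]
      rw [Finset.sum_comm]
      refine Finset.sum_congr rfl fun j _ => ?_
      simp only [Fin.getElem_fin, Fin.val_succ, List.take_succ_cons, List.map_cons, List.prod_cons,
        List.getElem_cons_succ, List.drop_succ_cons, Matrix.mul_assoc]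
      exact (Matrix.mul_apply (M := bulk J k i)).symm

theorem bulk_eq_zero {p q : Aux k} (h : blockPos q < blockPos p) : bulk J k i p q = 0 := by
  rcases p with _ | ⟨a, α⟩ <;> rcases q with _ | ⟨b, β⟩
  · simp [blockPos] at h
  · simp [blockPos] at h
  · exact bulk_inr_inl J k i _
  · simp only [blockPos] at h
    rw [bulk_inr_inr, if_neg (by omega)]

theorem bulk_prod_eq_zero (l : List (Fin L)) {p q : Aux k} (h : blockPos q < blockPos p) :
    (l.map (bulk J k)).prod p q = 0 := by
  induction l generalizing p with
  | nil =>
    have : p ≠ q := by rintro rfl; exact lt_irrefl _ h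
    simp [this]
  | cons i l ih =>
    rw [List.map_cons, List.prod_cons, Matrix.mul_apply]
    refine Finset.sum_eq_zero fun r _ => ?_
    by_cases hr : blockPos r < blockPos p
    · rw [bulk_eq_zero J k i hr, zero_mul]
    · rw [ih (lt_of_lt_of_le h (not_lt.1 hr)), mul_zero]

theorem bulk_prod_inl_inl (l : List (Fin L)) :
    (l.map (bulk J k)).prod (Sum.inl ()) (Sum.inl ()) = 1 := by
  induction l with
  | nil => simp
  | cons i l ih =>
    rw [List.map_cons, List.prod_cons, Matrix.mul_apply, Fintype.sum_sum_type]
    simp only [Finset.univ_unique, Finset.sum_singleton, PUnit.default_eq_unit, bulk_inl_inl, ih]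
    rw [Finset.sum_eq_zero, add_zero, one_mul]
    intro p _
    rw [bulk_prod_eq_zero, mul_zero]
    simp [blockPos]

theorem bulk_prod_inr_self (l : List (Fin L)) (hl : l ≠ []) (p : Fin (k - 1) × Letter) :
    (l.map (bulk J k)).prod (Sum.inr p) (Sum.inr p) = 0 := by
  rcases l with _ | ⟨i, l⟩
  · exact absurd rfl hl
  · rw [List.map_cons, List.prod_cons, Matrix.mul_apply]
    refine Finset.sum_eq_zero fun r _ => ?_
    rcases r with _ | r
    · rw [bulk_inr_inl, zero_mul]
    · by_cases hr : (p.1 : ℕ) < r.1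
      · rw [bulk_prod_eq_zero, mul_zero]
        simpa [blockPos] using hr
      · rw [show bulk J k i (Sum.inr p) (Sum.inr r) = 0 from ?_, zero_mul]
        rw [← Prod.mk.eta (p := p), ← Prod.mk.eta (p := r), bulk_inr_inr, if_neg hr]

theorem fst_trace_prod (l : List (Fin L)) (hl : l ≠ []) :
    (Matrix.trace (l.map (localTensor J k)).prod).fst = 1 := by
  rw [Matrix.trace, TrivSqZeroExt.fst_sum, Fintype.sum_sum_type]
  simp [fst_prod, bulk_prod_inl_inl, bulk_prod_inr_self J k l hl]

/-- In the `ε`-part of the trace the factors to the right of the corner can be moved to the front,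
since they act on other sites. -/
theorem trace_mul_cornerMatrix_mul {l₁ l₂ : List (Fin L)} {c : Fin L} (h : (l₁ ++ c :: l₂).Nodup) :
    Matrix.trace ((l₁.map (bulk J k)).prod * cornerMatrix k c * (l₂.map (bulk J k)).prod) =
      (((l₂ ++ l₁).map (bulk J k)).prod.mulVec (corner k c)) (Sum.inl ()) := by
  rw [List.map_append, List.prod_append, ← Matrix.mulVec_mulVec, Matrix.mulVec, dotProduct,
    Matrix.trace]
  refine Finset.sum_congr rfl fun p _ => ?_
  rw [Matrix.diag_apply, Matrix.mul_apply, Finset.sum_eq_single (Sum.inl ())]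
  · have h1 : ((l₁.map (bulk J k)).prod * cornerMatrix k c) p (Sum.inl ()) =
        ((l₁.map (bulk J k)).prod.mulVec (corner k c)) p := by
      simp [Matrix.mul_apply, Matrix.mulVec, dotProduct, cornerMatrix]
    rw [h1, Matrix.mulVec, dotProduct]
    refine (Commute.sum_right _ _ _ fun q _ => ?_).symm
    simp only [List.nodup_append, List.nodup_cons] at h
    obtain ⟨-, ⟨hc, -⟩, hd⟩ := h
    have key : ∀ i ∈ l₁ ++ [c], ∀ A,
        Commute ((l₂.map (bulk J k)).prod (Sum.inl ()) p) (siteOp i A) := by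
      intro i hi A
      refine (commute_bulk_prod J k (fun j hj B => siteOp_commute ?_ A B) _ _).symm
      rintro rfl
      rcases List.mem_append.1 hi with hi | hi
      · exact hd i hi i (by simp [hj]) rfl
      · exact hc (by simpa [List.mem_singleton.1 hi] using hj)
    exact (commute_bulk_prod J k (fun i hi => key i (by simp [hi])) _ _).mul_right
      (commute_corner k (key c (by simp)) _)
  · intro q _ hq
    rw [Matrix.mul_apply, Finset.sum_eq_zero, zero_mul]
    intro r _
    simp [cornerMatrix, hq]
  · simp

end Components

/-! ### Cyclic paths -/

section Cyclic

variable (J : Letter → ℂ) {L : ℕ} [NeZero L] (k : ℕ)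

/-- The `n` consecutive sites `i, i + 1, …, i + n - 1` of the periodic chain. -/
def sites : ℕ → Fin L → List (Fin L)
  | 0, _ => []
  | n + 1, i => i :: sites n (i + 1)

/-- Entry `p` is the sum over all paths of `n` steps in the auxiliary space from `p` to the last
block, followed by the corner; the operators act on the consecutive sites `i, …, i + n`. -/
def pathVec : ℕ → Fin L → Aux k → Op L
  | 0, i => corner k i
  | n + 1, i => (bulk J k i).mulVec (pathVec n (i + 1))

theorem sites_eq_map (n : ℕ) (i : Fin L) :
    sites n i = (List.range n).map fun m => i + Fin.ofNat L m := by
  induction n generalizing i with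
  | zero => rfl
  | succ n ih =>
    rw [sites, ih, List.range_succ_eq_map, List.map_cons, List.map_map]
    congr 1
    · ext; simp
    · refine List.map_congr_left fun m _ => ?_
      ext
      simp [Fin.val_add, add_comm, add_left_comm]

/-- The other sites from `i + 1` cyclically round to `i - 1`, and then `i` itself. -/
theorem finRange_rotate (i : Fin L) :
    (List.finRange L).drop (i + 1) ++ (List.finRange L).take i ++ [i] = sites L (i + 1) := by
  have h1 : (List.finRange L).take i ++ [i] = (List.finRange L).take (i + 1) := by
    rw [List.take_add_one]
    simp
  rw [List.append_assoc, h1, ← List.rotate_eq_drop_append_take (by simp), sites_eq_map]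
  refine List.ext_getElem (by simp) fun n h₁ h₂ => ?_
  ext
  simp [List.getElem_rotate, Fin.val_add, add_comm, add_left_comm]

theorem bulk_prod_mulVec_corner (n : ℕ) (i c : Fin L) (l : List (Fin L))
    (h : l ++ [c] = sites (n + 1) i) :
    (l.map (bulk J k)).prod.mulVec (corner k c) = pathVec J k n i := by
  induction n generalizing i l with
  | zero =>
    rcases l with _ | ⟨j, l⟩
    · simp_all [sites, pathVec]
    · simp [sites] at h
  | succ n ih =>
    rcases l with _ | ⟨j, l⟩
    · simp [sites] at h
    · rw [sites, List.cons_append, List.cons.injEq] at h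
      rw [List.map_cons, List.prod_cons, ← Matrix.mulVec_mulVec, ih (i + 1) l h.2, h.1, pathVec]

theorem snd_trace_prod :
    (Matrix.trace (List.ofFn fun i : Fin L => localTensor J k i).prod).snd =
      ∑ i : Fin L, pathVec J k (L - 1) i (Sum.inl ()) := by
  have hL : L - 1 + 1 = L := Nat.sub_add_cancel (NeZero.one_le)
  rw [List.ofFn_eq_map, Matrix.trace, TrivSqZeroExt.snd_sum]
  simp only [Matrix.diag_apply, snd_prod]
  rw [Finset.sum_comm, ← Equiv.sum_comp (Equiv.addRight (1 : Fin L))]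
  refine Fintype.sum_equiv (finCongr List.length_finRange) _ _ fun j => ?_
  have hsplit : (List.finRange L).take j ++ (List.finRange L)[j] :: (List.finRange L).drop (j + 1)
      = List.finRange L := by
    rw [Fin.getElem_fin, List.getElem_cons_drop, List.take_append_drop]
  have hj : (List.finRange L)[j] = finCongr List.length_finRange j := by
    ext; simp
  refine (trace_mul_cornerMatrix_mul J k (by rw [hsplit]; exact List.nodup_finRange L)).trans ?_
  refine congrFun (bulk_prod_mulVec_corner J k (L - 1) _ _ _ ?_) _
  rw [hL, hj]
  exact finRange_rotate (finCongr List.length_finRange j)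

theorem pathVec_succ (n : ℕ) (i : Fin L) (p : Aux k) :
    pathVec J k (n + 1) i p =
      bulk J k i p (Sum.inl ()) * pathVec J k n (i + 1) (Sum.inl ()) +
        ∑ q, bulk J k i p (Sum.inr q) * pathVec J k n (i + 1) (Sum.inr q) := by
  rw [pathVec, Matrix.mulVec, dotProduct, Fintype.sum_sum_type]
  simp

/-- A path that starts in the first block stays there for a number of sites and then leaves it;
by translation invariance only the number of steps after leaving matters. -/
theorem sum_pathVec_inl (n : ℕ) :
    ∑ i : Fin L, pathVec J k n i (Sum.inl ()) = ∑ m ∈ Finset.range n, ∑ i : Fin L,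
      ∑ q, bulk J k i (Sum.inl ()) (Sum.inr q) * pathVec J k m (i + 1) (Sum.inr q) := by
  induction n with
  | zero => simp [pathVec, corner]
  | succ n ih =>
    have h : ∀ i : Fin L, pathVec J k (n + 1) i (Sum.inl ()) = pathVec J k n (i + 1) (Sum.inl ()) +
        ∑ q, bulk J k i (Sum.inl ()) (Sum.inr q) * pathVec J k n (i + 1) (Sum.inr q) := by
      intro i
      rw [pathVec_succ, bulk_inl_inl, one_mul]
    rw [Finset.sum_range_succ, ← ih, Finset.sum_congr rfl fun i _ => h i, Finset.sum_add_distrib]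
    congr 1
    exact Equiv.sum_comp (Equiv.addRight (1 : Fin L)) fun i => pathVec J k n i (Sum.inl ())

end Cyclic

/-! ### Paths in the auxiliary space and words -/

open PowerSeries

/-- The words of length `n`. -/
def words : ℕ → Finset (List Letter)
  | 0 => {[]}
  | n + 1 => ((Finset.univ : Finset Letter) ×ˢ words n).image fun p => p.1 :: p.2

theorem mem_words {n : ℕ} {w : List Letter} : w ∈ words n ↔ w.length = n := by
  induction n generalizing w with
  | zero => simp [words]
  | succ n ih => rcases w with _ | ⟨a, w⟩ <;> simp [words, ih]

theorem sum_words_succ {M : Type*} [AddCommMonoid M] (n : ℕ) (f : List Letter → M) :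
    ∑ w ∈ words (n + 1), f w = ∑ α, ∑ w ∈ words n, f (α :: w) := by
  rw [words, Finset.sum_image, Finset.sum_product]
  rintro ⟨a, v⟩ _ ⟨b, w⟩ _ h
  simpa using h

section Weights

variable (J : Letter → ℂ)

/-- The generating function, by number of blocks climbed, of the steps that start a run of `β`,
without the coupling `J_β`: a step with superscript `n` climbs `2 n + 1` blocks. -/
noncomputable def runSeries (β : Letter) : ℂ⟦X⟧ :=
  X * expand 2 two_ne_zero (genR J (Pi.single β 1))

/-- The generating function of the steps that make a hole, without their couplings: a step with
superscript `n` climbs `2 n + 2` blocks. -/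
noncomputable def holeSeries : ℂ⟦X⟧ := X ^ 2 * expand 2 two_ne_zero (genR J 1)

/-- The generating function, by number of blocks climbed, of the steps from letter `α` to `β`. -/
noncomputable def stepSeries (α β : Letter) : ℂ⟦X⟧ :=
  if α = β then C (otherJ J α) * holeSeries J else C (-Complex.I * J β) * runSeries J β

/-- The generating function of all paths from letter `α` that spell the word `w`. -/
noncomputable def tailSeries : Letter → List Letter → ℂ⟦X⟧
  | _, [] => 1
  | α, β :: w => stepSeries J α β * tailSeries β w

/-- The generating function of all paths from the first block that spell the nonempty word `w`. -/
noncomputable def wordSeries : List Letter → ℂ⟦X⟧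
  | [] => 0
  | α :: w => C (J α) * runSeries J α * tailSeries J α w

theorem coeff_runSeries (β : Letter) (d : ℕ) :
    coeff d (runSeries J β) = if Odd d then diagR J ((d - 1) / 2) β else 0 := by
  have hβ : (Pi.single β 1 : Letter → ℕ) = fun γ => if γ = β then 1 else 0 := by
    ext γ; simp [Pi.single_apply]
  rcases d with _ | d
  · simp [runSeries]
  · rw [runSeries, coeff_succ_X_mul, coeff_expand, genR, hβ]
    simp only [coeff_mk, diagR, Nat.add_sub_cancel, Nat.odd_add_one, Nat.not_odd_iff_even,
      even_iff_two_dvd]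

theorem coeff_holeSeries (d : ℕ) :
    coeff d (holeSeries J) =
      if Even d ∧ d ≠ 0 then coeffR J (d / 2 - 1) (fun _ => 1) else 0 := by
  rw [holeSeries, coeff_X_pow_mul', coeff_expand, genR, coeff_mk]
  by_cases hd : 2 ≤ d
  · have h1 : 2 ∣ d - 2 ↔ (Even d ∧ d ≠ 0) := by rw [even_iff_two_dvd]; omega
    simp only [if_pos hd, h1]
    rw [show (d - 2) / 2 = d / 2 - 1 by omega]
    rfl
  · rw [if_neg hd, if_neg]
    rintro ⟨h1, h2⟩
    rw [even_iff_two_dvd] at h1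
    omega

theorem coeff_zero_stepSeries (α β : Letter) : coeff 0 (stepSeries J α β) = 0 := by
  rw [stepSeries]
  split_ifs
  · rw [coeff_C_mul, coeff_holeSeries]; simp
  · rw [coeff_C_mul, coeff_runSeries]; simp

theorem pauli_mul_self (α : Letter) : pauli α * pauli α = 1 := by
  ext i j
  cases α <;> fin_cases i <;> fin_cases j <;> simp [pauli]

variable {L : ℕ} (k : ℕ)

theorem bulk_inr_inr_eq (i : Fin L) (a b : Fin (k - 1)) (α β : Letter) :
    bulk J k i (Sum.inr (a, α)) (Sum.inr (b, β)) =
      (if (a : ℕ) ≤ b then coeff ((b : ℕ) - a) (stepSeries J α β) else 0) •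
        siteOp i (pauli α * pauli β) := by
  rw [bulk_inr_inr]
  rcases lt_trichotomy (a : ℕ) b with h | h | h
  · rw [if_pos h, if_pos h.le, stepSeries, blockMN, blockM, blockEN]
    have h0 : (b : ℕ) - a ≠ 0 := by omega
    by_cases hαβ : α = β
    · subst hαβ
      simp only [if_true, coeff_C_mul, coeff_holeSeries, ← Nat.not_odd_iff_even, smul_zero,
        pauli_mul_self, siteOp_one]
      split_ifs with h1 h2 h2
      · exact absurd h1 h2.1
      · simp
      · rfl
      · exact absurd ⟨h1, h0⟩ h2
    · simp only [if_neg hαβ, coeff_C_mul, coeff_runSeries]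
      split_ifs
      · rw [smul_smul]; congr 1; ring
      · simp
  · rw [if_neg h.not_lt, if_pos h.le, h, Nat.sub_self, coeff_zero_stepSeries, zero_smul]
  · rw [if_neg (by omega), if_neg (by omega), zero_smul]

theorem bulk_inl_inr_eq (i : Fin L) (b : Fin (k - 1)) (β : Letter) :
    bulk J k i (Sum.inl ()) (Sum.inr (b, β)) =
      coeff ((b : ℕ) + 1) (C (J β) * runSeries J β) • siteOp i (1 * pauli β) := by
  rw [bulk_inl_inr, coeff_C_mul, coeff_runSeries, one_mul]
  simp only [Nat.odd_add_one, Nat.not_odd_iff_even, Nat.add_sub_cancel]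
  split_ifs
  · rfl
  · simp

/-- Summing over the intermediate block `b` splits the climb from block `a` to the last block, so it
computes a coefficient of a product of two generating functions. -/
theorem sum_fin_eq_sum_antidiagonal {R : Type*} [Semiring R] (f g : ℕ → R) (a : Fin (k - 1)) :
    ∑ b : Fin (k - 1), (if (a : ℕ) ≤ b then f (b - a) else 0) * g (k - 2 - b) =
      ∑ p ∈ Finset.HasAntidiagonal.antidiagonal (k - 2 - a), f p.1 * g p.2 := by
  rw [Fin.sum_univ_eq_sum_range (fun b => (if (a : ℕ) ≤ b then f (b - a) else 0) * g (k - 2 - b))]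
  simp only [ite_mul, zero_mul]
  rw [← Finset.sum_filter]
  have ha := a.2
  refine Finset.sum_bij' (fun b _ => (b - a, k - 2 - b)) (fun p _ => p.1 + a) ?_ ?_ ?_ ?_ ?_
  · intro b hb; simp at hb ⊢; omega
  · rintro ⟨p, q⟩ hp; simp at hp ⊢; omega
  · intro b hb; simp at hb ⊢; omega
  · rintro ⟨p, q⟩ hp; simp at hp ⊢; omega
  · intro b _; rfl

variable [NeZero L]

/-- The paths that start in the last `k - 1` blocks, grouped by the word that they spell. -/
theorem pathVec_inr (n : ℕ) (i : Fin L) (a : Fin (k - 1)) (α : Letter) :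
    pathVec J k n i (Sum.inr (a, α)) =
      ∑ w ∈ words n, coeff (k - 2 - a) (tailSeries J α w) • doublingString (pauli α) w i := by
  induction n generalizing i a α with
  | zero =>
    have ha := a.2
    have h : (a : ℕ) + 2 = k ↔ k - 2 - (a : ℕ) = 0 := by omega
    simp only [pathVec, corner, words, Finset.sum_singleton, tailSeries, doublingString,
      coeff_one, h, sigma]
    split_ifs <;> simp
  | succ n ih =>
    rw [pathVec_succ, bulk_inr_inl, zero_mul, zero_add, sum_words_succ, Fintype.sum_prod_type_right]
    refine Finset.sum_congr rfl fun β _ => ?_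
    simp only [ih, bulk_inr_inr_eq, Finset.mul_sum, smul_mul_smul_comm]
    rw [Finset.sum_comm]
    refine Finset.sum_congr rfl fun w _ => ?_
    rw [← Finset.sum_smul, tailSeries, coeff_mul, ← sum_fin_eq_sum_antidiagonal k
      (fun d => coeff d (stepSeries J α β)) (fun d => coeff d (tailSeries J β w)) a, doublingString]

/-- The paths that leave the first block at site `i`, grouped by the word that they spell. -/
theorem sum_bulk_mul_pathVec (hk : 2 ≤ k) (n : ℕ) (i : Fin L) :
    ∑ q, bulk J k i (Sum.inl ()) (Sum.inr q) * pathVec J k n (i + 1) (Sum.inr q) =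
      ∑ w ∈ words (n + 1), coeff (k - 1) (wordSeries J w) • doublingString 1 w i := by
  rw [sum_words_succ, Fintype.sum_prod_type_right]
  refine Finset.sum_congr rfl fun β _ => ?_
  simp only [pathVec_inr, bulk_inl_inr_eq, Finset.mul_sum, smul_mul_smul_comm]
  rw [Finset.sum_comm]
  refine Finset.sum_congr rfl fun w _ => ?_
  have h := sum_fin_eq_sum_antidiagonal k (fun d => coeff (d + 1) (C (J β) * runSeries J β))
    (fun d => coeff d (tailSeries J β w)) ⟨0, by omega⟩
  simp only [zero_le, if_true, Nat.sub_zero] at h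
  rw [← Finset.sum_smul, h, wordSeries, show k - 1 = k - 2 + 1 by omega, coeff_mul,
    Finset.Nat.sum_antidiagonal_succ, coeff_C_mul, coeff_runSeries]
  simp [doublingString]

/-- The `ε`-part of the trace as a sum over words of length less than `L`. -/
theorem snd_trace_prod_eq_sum_words (hk : 2 ≤ k) :
    (Matrix.trace (List.ofFn fun i : Fin L => localTensor J k i).prod).snd =
      ∑ n ∈ Finset.range (L - 1), ∑ w ∈ words (n + 1),
        coeff (k - 1) (wordSeries J w) • doublingProduct L w := by
  rw [snd_trace_prod, sum_pathVec_inl]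
  refine Finset.sum_congr rfl fun n _ => ?_
  simp only [sum_bulk_mul_pathVec J k hk, doublingProduct, Finset.smul_sum]
  exact Finset.sum_comm

end Weights

/-! ### Words and their runs -/

/-- The word with given runs: `(A, m)` stands for `m + 1` letters `A`. -/
def ofRuns (r : List (Letter × ℕ)) : List Letter :=
  r.flatMap fun p => List.replicate (p.2 + 1) p.1

/-- The run-length encoding of a word, with each length lowered by one. -/
def runs : List Letter → List (Letter × ℕ)
  | [] => []
  | a :: w =>
    match runs w with
    | [] => [(a, 0)]
    | (b, n) :: r => if a = b then (b, n + 1) :: r else (a, 0) :: (b, n) :: r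

theorem ofRuns_runs (w : List Letter) : ofRuns (runs w) = w := by
  induction w with
  | nil => rfl
  | cons a w ih =>
    rw [runs]
    rcases h : runs w with _ | ⟨⟨b, n⟩, r⟩
    · rw [h] at ih
      simp [ofRuns, ← ih]
    · rw [h] at ih
      simp only
      split_ifs with hab
      · subst hab
        rw [← ih]
        simp [ofRuns, List.replicate_succ]
      · rw [← ih]
        simp [ofRuns]

theorem isChain_runs (w : List Letter) : (runs w).IsChain fun p q => p.1 ≠ q.1 := by
  induction w with
  | nil => exact List.isChain_nil
  | cons a w ih =>
    rw [runs]
    rcases h : runs w with _ | ⟨⟨b, n⟩, r⟩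
    · exact List.isChain_singleton _
    · rw [h] at ih
      simp only
      split_ifs with hab
      · rw [List.isChain_cons] at ih ⊢
        exact ih
      · exact List.isChain_cons_cons.2 ⟨hab, ih⟩

theorem runs_ofRuns {r : List (Letter × ℕ)} (h : r.IsChain fun p q => p.1 ≠ q.1) :
    runs (ofRuns r) = r := by
  induction r with
  | nil => rfl
  | cons p r ih =>
    obtain ⟨a, n⟩ := p
    rw [List.isChain_cons] at h
    have hr := ih h.2
    rw [ofRuns, List.flatMap_cons, ← ofRuns]
    induction n with
    | zero =>
      simp only [zero_add, List.replicate_one, List.cons_append, List.nil_append, runs, hr]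
      rcases r with _ | ⟨⟨b, m⟩, r⟩
      · rfl
      · simp only
        rw [if_neg (by simpa using h.1 (b, m))]
    | succ n ihn =>
      rw [List.replicate_succ, List.cons_append, runs, ihn (by simpa using h)]
      simp

theorem runWord_eq_ofRuns {t : ℕ} (A : Fin t → Letter) (μ : Fin t → ℕ) :
    runWord A μ = ofRuns (List.ofFn fun r => (A r, μ r)) := by
  rw [runWord, ofRuns, List.flatMap_def, List.map_ofFn]
  rfl

theorem length_runWord {t : ℕ} (A : Fin t → Letter) (μ : Fin t → ℕ) :
    (runWord A μ).length = t + ∑ r, μ r := by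
  rw [runWord, List.length_flatten, List.map_ofFn, List.sum_ofFn]
  simp [Finset.sum_add_distrib, add_comm]

theorem mem_doublingSet {t m : ℕ} {A : Fin t → Letter} {μ : Fin t → ℕ} :
    (A, μ) ∈ doublingSet t m ↔
      (List.ofFn fun r => (A r, μ r)).IsChain (fun p q => p.1 ≠ q.1) ∧ ∑ r, μ r = m := by
  simp only [doublingSet, Finset.mem_product, Finset.mem_filter, Finset.mem_univ, true_and,
    Finset.mem_piAntidiag, implies_true, and_true, List.isChain_ofFn]
  refine and_congr_left fun _ => ⟨fun h i hi => h _ _ rfl, fun h r s hrs => ?_⟩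
  have := h r (by omega)
  rwa [show (⟨(r : ℕ) + 1, by omega⟩ : Fin t) = s from Fin.ext hrs] at this

theorem exists_runWord (w : List Letter) : ∃ (t m : ℕ) (A : Fin t → Letter)
    (μ : Fin t → ℕ), (A, μ) ∈ doublingSet t m ∧ runWord A μ = w := by
  have h : (List.ofFn fun r : Fin (runs w).length => ((runs w)[r].1, (runs w)[r].2)) = runs w :=
    List.ofFn_getElem
  refine ⟨(runs w).length, _, fun r => (runs w)[r].1, fun r => (runs w)[r].2,
    mem_doublingSet.2 ⟨?_, rfl⟩, ?_⟩
  · rw [h]; exact isChain_runs w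
  · rw [runWord_eq_ofRuns, h, ofRuns_runs]

/-- A word determines its list of runs. It is compared as a list since the number of runs, on which
the type of `(A, μ)` depends, is itself to be recovered from the word. -/
theorem ofFn_eq_of_runWord_eq {t t' m m' : ℕ} {A : Fin t → Letter} {μ : Fin t → ℕ}
    {A' : Fin t' → Letter} {μ' : Fin t' → ℕ} (h : (A, μ) ∈ doublingSet t m)
    (h' : (A', μ') ∈ doublingSet t' m') (he : runWord A μ = runWord A' μ') :
    (List.ofFn fun r => (A r, μ r)) = List.ofFn fun r => (A' r, μ' r) := by
  rw [← runs_ofRuns (mem_doublingSet.1 h).1, ← runs_ofRuns (mem_doublingSet.1 h').1,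
    ← runWord_eq_ofRuns, ← runWord_eq_ofRuns, he]

/-! ### The weight of a word -/

section Weights

variable (J : Letter → ℂ)

/-- The factor that a run contributes to the weight of a word. -/
noncomputable def runWeight (p : Letter × ℕ) : ℂ⟦X⟧ :=
  C (-Complex.I * J p.1) * runSeries J p.1 * (C (otherJ J p.1) * holeSeries J) ^ p.2

theorem tailSeries_replicate_append (α : Letter) (n : ℕ) (w : List Letter) :
    tailSeries J α (List.replicate n α ++ w) =
      (C (otherJ J α) * holeSeries J) ^ n * tailSeries J α w := by
  induction n with
  | zero => simp
  | succ n ih =>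
    rw [List.replicate_succ, List.cons_append, tailSeries, ih, stepSeries, if_pos rfl, pow_succ']
    ring

theorem tailSeries_ofRuns {α : Letter} {n : ℕ} {r : List (Letter × ℕ)}
    (h : ((α, n) :: r).IsChain fun p q => p.1 ≠ q.1) :
    tailSeries J α (ofRuns r) = (r.map (runWeight J)).prod := by
  induction r generalizing α n with
  | nil => simp [ofRuns, tailSeries]
  | cons p r ih =>
    obtain ⟨β, m⟩ := p
    obtain ⟨hne, hr⟩ := List.isChain_cons_cons.1 h
    rw [ofRuns, List.flatMap_cons, ← ofRuns, List.replicate_succ, List.cons_append, tailSeries,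
      tailSeries_replicate_append, stepSeries, if_neg hne, ih hr, List.map_cons, List.prod_cons,
      runWeight]
    ring

theorem wordSeries_ofRuns {r : List (Letter × ℕ)} (hr : r ≠ [])
    (h : r.IsChain fun p q => p.1 ≠ q.1) :
    C (-Complex.I) * wordSeries J (ofRuns r) = (r.map (runWeight J)).prod := by
  obtain ⟨⟨β, m⟩, r, rfl⟩ := List.exists_cons_of_ne_nil hr
  rw [ofRuns, List.flatMap_cons, ← ofRuns, List.replicate_succ, List.cons_append, wordSeries,
    tailSeries_replicate_append, tailSeries_ofRuns J h, List.map_cons, List.prod_cons,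
    runWeight, map_mul]
  ring

theorem genR_sum {ι : Type*} (s : Finset ι) (N : ι → Letter → ℕ) :
    genR J (∑ r ∈ s, N r) = ∏ r ∈ s, genR J (N r) := by
  classical
  induction s using Finset.induction_on with
  | empty => simp [genR_zero]
  | insert a s ha ih => rw [Finset.sum_insert ha, Finset.prod_insert ha, genR_add, ih]

theorem prod_runWeight {t : ℕ} (A : Fin t → Letter) (μ : Fin t → ℕ) :
    ∏ r, runWeight J (A r, μ r) =
      C ((-Complex.I) ^ t * couplingJ J A μ) * (X ^ (t + 2 * ∑ r, μ r) *
        expand 2 two_ne_zero (genR J fun α => letterCount A α + ∑ r, μ r)) := by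
  have hN : (fun α => letterCount A α + ∑ r, μ r) =
      ∑ r, (Pi.single (A r) 1 : Letter → ℕ) + ∑ _x ∈ Finset.range (∑ r, μ r), (1 : Letter → ℕ) := by
    ext α
    simp [letterCount, Finset.sum_apply, Pi.single_apply, @eq_comm _ α]
  rw [hN, genR_add, genR_sum, genR_sum]
  simp only [runWeight, runSeries, holeSeries, couplingJ, mul_pow, Finset.prod_mul_distrib,
    Finset.prod_const, Finset.prod_pow_eq_pow_sum, map_mul, map_prod, map_pow, Finset.card_univ,
    Fintype.card_fin, Finset.card_range, pow_add, pow_mul]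
  ring

/-- The weight of a word, by its runs. The superscripts along a path are convolved, and by
multiplicativity of the generating functions of `R_n` only their sum matters. -/
theorem coeff_wordSeries_runWord {t m : ℕ} (ht : t ≠ 0) {A : Fin t → Letter} {μ : Fin t → ℕ}
    (h : (A, μ) ∈ doublingSet t m) (d : ℕ) :
    coeff d (wordSeries J (runWord A μ)) =
      if t + 2 * m ≤ d ∧ 2 ∣ d - (t + 2 * m) then
        coeffR J ((d - (t + 2 * m)) / 2) (fun α => letterCount A α + m) *
          couplingJ J A μ * (-Complex.I) ^ (t - 1)
      else 0 := by
  obtain ⟨hchain, rfl⟩ := mem_doublingSet.1 h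
  have h1 := wordSeries_ofRuns J (by simpa using ht) hchain
  rw [← runWord_eq_ofRuns, List.map_ofFn, List.prod_ofFn] at h1
  have h2 := congrArg (coeff d) (h1.trans (prod_runWeight J A μ))
  rw [coeff_C_mul, coeff_C_mul, coeff_X_pow_mul', coeff_expand, genR, coeff_mk] at h2
  refine mul_left_cancel₀ (neg_ne_zero.2 Complex.I_ne_zero) (h2.trans ?_)
  obtain ⟨t, rfl⟩ := Nat.exists_eq_succ_of_ne_zero ht
  rw [ite_and, pow_succ]
  split_ifs
  · simp only [Nat.succ_eq_add_one, Nat.add_sub_cancel]; ring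
  · simp
  · simp

end Weights

/-! ### The charge as a sum over words -/

/-- The charge, with each pair of runs and holes replaced by the word that it spells. A word in the
charge has length `k - 2 n - m - 1 < L`, and a word that does not occur there has weight `0`, either
for parity reasons or because it climbs too many blocks. -/
theorem charge_eq_sum_words (J : Letter → ℂ) {k L : ℕ} [NeZero L] (hk : 2 ≤ k) (hL : k ≤ L) :
    charge J L k = ∑ n ∈ Finset.range (L - 1), ∑ w ∈ words (n + 1),
      coeff (k - 1) (wordSeries J w) • doublingProduct L w := by
  rw [charge, Finset.sum_sigma', ← Finset.sum_biUnion]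
  swap
  · intro a _ b _ hab
    refine Finset.disjoint_left.2 fun w ha hb => hab ?_
    have h1 := mem_words.1 ha
    have h2 := mem_words.1 hb
    omega
  have hk2 : k / 2 * 2 ≤ k := Nat.div_mul_le_self k 2
  refine Finset.sum_of_injOn (fun x => runWord x.2.1 x.2.2) ?_ ?_ ?_ ?_
  · rintro ⟨⟨n, m⟩, A, μ⟩ hx ⟨⟨n', m'⟩, A', μ'⟩ hx' he
    simp only [Finset.coe_sigma, Set.mem_sigma_iff, Finset.mem_coe, Finset.mem_filter] at hx hx' he
    have hofn := ofFn_eq_of_runWord_eq hx.2 hx'.2 he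
    have ht : k - 2 * (n + m) - 1 = k - 2 * (n' + m') - 1 := by
      simpa using congrArg List.length hofn
    have hm : m = m' := by
      have hlen := congrArg List.length he
      rw [length_runWord, length_runWord, (mem_doublingSet.1 hx.2).2,
        (mem_doublingSet.1 hx'.2).2] at hlen
      omega
    obtain rfl := hm
    have hn : n = n' := by omega
    obtain rfl := hn
    have hf := List.ofFn_injective hofn
    have hA : A = A' := funext fun r => congrArg Prod.fst (congrFun hf r)
    have hμ : μ = μ' := funext fun r => congrArg Prod.snd (congrFun hf r)
    rw [hA, hμ]
  · rintro ⟨⟨n, m⟩, A, μ⟩ hx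
    simp only [Finset.coe_sigma, Set.mem_sigma_iff, Finset.mem_coe, Finset.mem_filter] at hx
    have hlen := length_runWord A μ
    rw [(mem_doublingSet.1 hx.2).2] at hlen
    simp only [Finset.coe_biUnion, Set.mem_iUnion, Finset.mem_coe, mem_words, hlen,
      Finset.mem_range, exists_prop]
    exact ⟨k - 2 * (n + m) - 1 + m - 1, by omega, by omega⟩
  · intro w hw hnot
    obtain ⟨n₀, -, hw⟩ := Finset.mem_biUnion.1 hw
    obtain ⟨t, m, A, μ, hA, rfl⟩ := exists_runWord w
    have hlen := mem_words.1 hw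
    rw [length_runWord] at hlen
    have ht : t ≠ 0 := by
      rintro rfl
      simp at hlen
    rw [coeff_wordSeries_runWord J ht hA, if_neg, zero_smul]
    -- a nonzero coefficient would give a superscript `n` for which the word occurs in the charge
    rintro ⟨h1, n, h2⟩
    obtain rfl : t = k - 2 * (n + m) - 1 := by omega
    refine hnot ⟨⟨(n, m), A, μ⟩, ?_, rfl⟩
    simp only [Finset.coe_sigma, Set.mem_sigma_iff, Finset.mem_coe, Finset.mem_filter,
      Finset.mem_product, Finset.mem_range]
    exact ⟨by omega, hA⟩
  · rintro ⟨⟨n, m⟩, A, μ⟩ hx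
    simp only [Finset.mem_sigma, Finset.mem_filter] at hx
    rw [coeff_wordSeries_runWord J (by omega) hx.2, if_pos (by omega), abbrevDoubling, smul_smul,
      show (k - 1 - (k - 2 * (n + m) - 1 + 2 * m)) / 2 = n by omega]

end XYZChain

theorem theorem1 (J : XYZChain.Letter → ℂ) (k L : ℕ) [NeZero L] (hk : 2 ≤ k) (hL : k ≤ L) :
    Fintype.card (XYZChain.Aux k) = 3 * k - 2 ∧
    (∀ (i : Fin L) (p q : XYZChain.Aux k),
      XYZChain.blockPos q < XYZChain.blockPos p →
      ¬ (XYZChain.blockPos p = k ∧ XYZChain.blockPos q = 1) →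
      XYZChain.localTensor J k i p q = 0) ∧
    Matrix.trace (List.ofFn fun i : Fin L => XYZChain.localTensor J k i).prod =
      1 + DualNumber.eps * TrivSqZeroExt.inl (XYZChain.charge J L k) := by
  refine ⟨?_, fun i p q hqp hcorner => ?_, ?_⟩
  · have h : Fintype.card XYZChain.Letter = 3 := rfl
    simp only [Fintype.card_sum, Fintype.card_unit, Fintype.card_prod, Fintype.card_fin, h]
    omega
  · refine TrivSqZeroExt.ext (XYZChain.bulk_eq_zero J k i hqp) ?_
    rw [XYZChain.localTensor_snd]
    rcases p with _ | ⟨a, α⟩ <;> rcases q with _ | ⟨b, β⟩ <;>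
      simp_all [XYZChain.cornerMatrix, XYZChain.corner, XYZChain.blockPos]
  · refine TrivSqZeroExt.ext ?_ ?_
    · have hne : List.finRange L ≠ [] := by simp [NeZero.ne L]
      rw [List.ofFn_eq_map, XYZChain.fst_trace_prod J k _ hne]
      simp
    · rw [XYZChain.snd_trace_prod_eq_sum_words J k hk, XYZChain.charge_eq_sum_words J hk hL]
      simp
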